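/- All graphs are finite and simple. An \emph{integer weighted tree} $(T,w)$ is a tree $T$ with a weight function $w:V(T)\to\mathbb{Z}^+$. PSD-throttling: given a set of blue vertices in a graph $G$ (all others are white), a blue vertex $v$ forces a white vertex $x$ to become blue if $x$ is the only neighbor of $v$ in some connected component of the subgraph induced by the white vertices. Starting with blue set $B\subseteq V(G)$, in each time-step all possible forces are performed simultaneously; $\operatorname{pt_+}(G;B)$ is the least $k\ge 0$ such that all of $V(G)$ is blue after $k$ time-steps ($\infty$ if there is none). The PSD-throttling number of $(G,w)$ is \[\operatorname{th_+}(G,w)=\min_{B\subseteq V(G)}\Big(\sum_{x\in B}w(x)+\operatorname{pt_+}(G;B)\Big).\] Concentration: the branches of $T$ at a vertex $v$ are the components of $T-v$. Two branches $T_1,T_2$ at $v$ are symmetric if there is an automorphism $\sigma$ of $T$ fixing every vertex outside $V(T_1)\cup V(T_2)$, with $\sigma(V(T_1))=V(T_2)$, $\sigma(V(T_2))=V(T_1)$, and $w(x)=w(\sigma(x))$ for all $x\in V(T_1)$. Let $v$ be a vertex with $w(v)=1$ and let $\{T_1,\dots,T_m\}$, $m\ge 1$, be a maximal set of pairwise symmetric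 branches of $T$ at $v$. The weighted tree obtained from $T$ by deleting the branches $T_2,\dots,T_m$, with weights $w'(x)=m\,w(x)$ for $x\in V(T_1)$ and $w'(x)=w(x)$ for all other remaining vertices $x$, is a single concentration of $(T,w)$. A concentration of $(T,w)$ is a weighted tree obtained from it, up to isomorphism, by one or more successive single concentrations. Theorem. Let $(T,w)$ be an integer weighted tree and let $(T',w')$ be a concentration of $(T,w)$. Then \[\operatorname{th_+}(T,w)=\operatorname{th_+}(T',w').\] -/

import Mathlib

open scoped NNReal ENNReal

universe u

namespace PSD

variable {V : Type u}

/-- `Forces G B v w`: with `B` the set of blue vertices, the blue vertex `v` forces the white vertex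
`w` under the PSD color change rule, i.e. for some connected component `W` of `G - B`, the vertex
`w` is the only neighbor of `v` in `W` (equivalently, the only white neighbor of `v` in
`G[W ∪ B]`). -/
def Forces (G : SimpleGraph V) (B : Set V) (v w : V) : Prop :=
  v ∈ B ∧ ∃ W : (G.induce Bᶜ).ConnectedComponent,
    {x : V | G.Adj v x ∧ x ∈ Subtype.val '' W.supp} = {w}

/-- The set of vertices that are blue after `k` time-steps, starting from the blue set `B`; in each
time-step all possible forces are performed simultaneously. -/
def blueAfter (G : SimpleGraph V) (B : Set V) : ℕ → Set V
  | 0 => B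
  | k + 1 => blueAfter G B k ∪ {w | ∃ v, Forces G (blueAfter G B k) v w}

/-- The PSD-propagation time of `B`: the least `k` such that all vertices are blue after `k`
time-steps, and `⊤` if `B` is not a PSD-forcing set. -/
noncomputable def propTime (G : SimpleGraph V) (B : Set V) : ℕ∞ :=
  ⨅ (k : ℕ) (_ : blueAfter G B k = Set.univ), (k : ℕ∞)

end PSD

/-- A finite graph with positive real weights on its vertices. -/
structure WeightedGraph where
  V : Type u
  finite : Finite V
  graph : SimpleGraph V
  w : V → ℝ≥0
  w_pos : ∀ x, 0 < w x

namespace WeightedGraph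

/-- All weights are integers (positive ones, since weights are positive). -/
def IsIntegerWeighted (T : WeightedGraph.{u}) : Prop :=
  ∀ x, ∃ n : ℕ, T.w x = n

/-- The PSD-throttling number of a set `B` of vertices: its weight plus its propagation time. -/
noncomputable def throttlingOf (T : WeightedGraph.{u}) (B : Finset T.V) : ℝ≥0∞ :=
  ((∑ x ∈ B, T.w x : ℝ≥0) : ℝ≥0∞) + (PSD.propTime T.graph (B : Set T.V) : ℝ≥0∞)

/-- The PSD-throttling number of a weighted graph. There are finitely many sets `B`, so this
infimum is a minimum. -/
noncomputable def throttling (T : WeightedGraph.{u}) : ℝ≥0∞ :=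
  ⨅ B : Finset T.V, T.throttlingOf B

/-- `S` is the vertex set of a branch of `T` at `v`, i.e. of a connected component of `T - v`. -/
def IsBranch (T : WeightedGraph.{u}) (v : T.V) (S : Set T.V) : Prop :=
  ∃ C : (T.graph.induce {v}ᶜ).ConnectedComponent, S = Subtype.val '' C.supp

/-- The branches with vertex sets `S₁` and `S₂` are symmetric: some automorphism of the graph swaps
them, fixes every other vertex, and preserves the weights. -/
def SymmetricBranches (T : WeightedGraph.{u}) (S₁ S₂ : Set T.V) : Prop :=
  ∃ σ : T.graph ≃g T.graph,
    (∀ x, x ∉ S₁ ∪ S₂ → σ x = x) ∧ σ '' S₁ = S₂ ∧ σ '' S₂ = S₁ ∧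
      ∀ x ∈ S₁, T.w x = T.w (σ x)

/-- `F` is a set of pairwise symmetric branches of `T` at `v`. -/
def IsSymmetricFamily (T : WeightedGraph.{u}) (v : T.V) (F : Set (Set T.V)) : Prop :=
  (∀ S ∈ F, T.IsBranch v S) ∧ F.Pairwise T.SymmetricBranches

/-- `T'` is (isomorphic to) a single concentration of `T` at a vertex `v` of weight `1`: for a
maximal set `F` of pairwise symmetric branches at `v`, all branches in `F` but the branch `S₁` are
deleted, and the weights on `S₁` are multiplied by the number of branches in `F`. -/
def IsSingleConcentration (T T' : WeightedGraph.{u}) : Prop :=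
  ∃ (v : T.V) (F : Set (Set T.V)) (S₁ : Set T.V),
    T.w v = 1 ∧ Maximal (T.IsSymmetricFamily v) F ∧ S₁ ∈ F ∧
    ∃ e : T'.graph ≃g T.graph.induce (⋃₀ (F \ {S₁}))ᶜ, ∀ x : T'.V,
      ((e x : T.V) ∈ S₁ → T'.w x = (F.ncard : ℝ≥0) * T.w (e x)) ∧
      ((e x : T.V) ∉ S₁ → T'.w x = T.w (e x))

/-- `T'` is obtained from `T` by one or more iterated single concentrations. -/
def IsConcentration (T T' : WeightedGraph.{u}) : Prop :=
  Relation.TransGen IsSingleConcentration T T'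

end WeightedGraph

/-! ### Distances under homomorphisms and across a cut vertex -/

namespace SimpleGraph

variable {V : Type*} {W : Type*}

/-! In a tree a blue vertex forces all its white neighbours, so throttling minimises the weight of
`B` plus its covering radius (`mem_blueAfter_iff`). It suffices to turn covers of one tree into
covers of the other with the same radius and no more weight.

From the concentrated tree, take the preimage under the map folding all branches in `F` onto `S₁`
(`exists_unfolded_cover`). Conversely, keep the part of `B` outside the branches and fold the part
in a lightest branch `S` (`exists_folded_cover`). What is discarded reached other branches only
through `v`, so any kept vertex at least as close to `v` replaces it. If the vertex of `B` closest
to `v` lies outside the branches or in a lightest one, its fold is kept. Otherwise its branch is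
heavier than `S` by at least 1, which pays for adding `v`. -/

theorem Connected.dist_map_le {G : SimpleGraph V} {H : SimpleGraph W} (hG : G.Connected)
    (f : G →g H) (x y : V) : H.dist (f x) (f y) ≤ G.dist x y := by
  obtain ⟨p, hp⟩ := hG.exists_walk_length_eq_dist x y
  rw [← hp, ← Walk.length_map f p]
  exact dist_le _

/-- Every walk that leaves a branch at `v` passes through `v`. -/
theorem Walk.mem_support_of_leaves {G : SimpleGraph V} {v : V} {S : Set V}
    (hS : ∀ x ∈ S, ∀ y, G.Adj x y → y ≠ v → y ∈ S) {x y : V} (p : G.Walk x y)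
    (hx : x ∈ S) (hy : y ∉ S) : v ∈ p.support := by
  induction p with
  | nil => exact absurd hx hy
  | @cons a b c h q ih =>
    by_cases hb : b = v
    · subst hb
      simp
    · exact List.mem_cons_of_mem _ (ih (hS _ hx _ h hb) hy)

theorem Connected.dist_add_dist_le_of_leaves {G : SimpleGraph V} (hG : G.Connected) {v : V}
    {S : Set V} (hS : ∀ x ∈ S, ∀ y, G.Adj x y → y ≠ v → y ∈ S) {x y : V}
    (hx : x ∈ S) (hy : y ∉ S) : G.dist x v + G.dist v y ≤ G.dist x y := by
  classical
  obtain ⟨p, hp⟩ := hG.exists_walk_length_eq_dist x y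
  have hv := p.mem_support_of_leaves hS hx hy
  rw [← hp, ← p.take_spec hv, Walk.length_append]
  exact add_le_add (dist_le _) (dist_le _)

end SimpleGraph

/-! ### PSD forcing in trees as covering by balls -/

namespace PSD

variable {V : Type u} {G : SimpleGraph V}

/-- Two neighbours of `v` in one white component would be joined by a path avoiding `v`,
contradicting uniqueness of paths. -/
theorem forces_iff_of_isAcyclic (hG : G.IsAcyclic) {B : Set V} {v w : V} :
    Forces G B v w ↔ v ∈ B ∧ w ∉ B ∧ G.Adj v w := by
  constructor
  · rintro ⟨hv, W, hW⟩
    have hw : w ∈ {x : V | G.Adj v x ∧ x ∈ Subtype.val '' W.supp} := by rw [hW]; rfl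
    obtain ⟨hadj, z, -, rfl⟩ := hw
    exact ⟨hv, z.2, hadj⟩
  · rintro ⟨hv, hw, hadj⟩
    refine ⟨hv, (G.induce Bᶜ).connectedComponentMk ⟨w, hw⟩, ?_⟩
    ext x
    simp only [Set.mem_ofPred_eq, Set.mem_singleton_iff]
    constructor
    · rintro ⟨hx, z, hz, rfl⟩
      have hr : (G.induce Bᶜ).Reachable ⟨w, hw⟩ z :=
        (SimpleGraph.ConnectedComponent.exact hz).symm
      obtain ⟨p, hp⟩ := hr.exists_isPath
      let q : G.Walk w z := p.map (SimpleGraph.Embedding.induce Bᶜ).toHom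
      have hq : q.IsPath :=
        SimpleGraph.Walk.IsPath.map (f := (SimpleGraph.Embedding.induce Bᶜ).toHom)
          Subtype.val_injective hp
      have hvq : v ∉ q.support := by
        intro h
        have hs : q.support = p.support.map Subtype.val := SimpleGraph.Walk.support_map _ p
        rw [hs, List.mem_map] at h
        obtain ⟨y, -, rfl⟩ := h
        exact y.2 hv
      have h1 : (SimpleGraph.Walk.cons hadj q).IsPath := hq.cons hvq
      have h2 : (SimpleGraph.Walk.cons hx SimpleGraph.Walk.nil).IsPath := by
        simp [hx.ne]
      have h3 := (hG.subsingleton_path v z).elim ⟨_, h1⟩ ⟨_, h2⟩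
      have h4 := congrArg (fun r : G.Path v z => r.1.length) h3
      simp only [SimpleGraph.Walk.length_cons, SimpleGraph.Walk.length_nil] at h4
      exact (SimpleGraph.Walk.eq_of_length_eq_zero (p := q) (by omega)).symm
    · rintro rfl
      exact ⟨hadj, ⟨x, hw⟩, rfl, rfl⟩

/-- In a tree the vertices that are blue after `k` steps are those at distance at most `k`. -/
theorem mem_blueAfter_iff (hG : G.IsTree) {B : Set V} {k : ℕ} {x : V} :
    x ∈ blueAfter G B k ↔ ∃ b ∈ B, G.dist b x ≤ k := by
  induction k generalizing x with
  | zero =>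
    simp only [blueAfter, Nat.le_zero]
    constructor
    · exact fun h => ⟨x, h, SimpleGraph.dist_self⟩
    · rintro ⟨b, hb, h⟩
      rwa [← (hG.connected.dist_eq_zero_iff).1 h]
  | succ k ih =>
    simp only [blueAfter, Set.mem_union, Set.mem_ofPred_eq, forces_iff_of_isAcyclic hG.isAcyclic]
    constructor
    · rintro (h | ⟨y, hy, -, hadj⟩)
      · obtain ⟨b, hb, h⟩ := ih.1 h
        exact ⟨b, hb, by omega⟩
      · obtain ⟨b, hb, h⟩ := ih.1 hy
        have h1 := hG.connected.dist_triangle (u := b) (v := y) (w := x)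
        have h2 := SimpleGraph.dist_eq_one_iff_adj.2 hadj
        exact ⟨b, hb, by omega⟩
    · rintro ⟨b, hb, h⟩
      by_cases hx : x ∈ blueAfter G B k
      · exact Or.inl hx
      right
      obtain ⟨p, hp⟩ := hG.connected.exists_walk_length_eq_dist x b
      rw [SimpleGraph.dist_comm, ← hp] at h
      cases p with
      | nil => exact absurd (ih.2 ⟨x, hb, by simp⟩) hx
      | @cons _ y _ hadj q =>
        refine ⟨y, ih.2 ⟨b, hb, ?_⟩, hx, hadj.symm⟩
        rw [SimpleGraph.dist_comm]
        have := SimpleGraph.dist_le q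
        simp only [SimpleGraph.Walk.length_cons] at h
        omega

theorem blueAfter_eq_univ_iff (hG : G.IsTree) {B : Set V} {k : ℕ} :
    blueAfter G B k = Set.univ ↔ ∀ x, ∃ b ∈ B, G.dist b x ≤ k := by
  simp [Set.eq_univ_iff_forall, mem_blueAfter_iff hG]

theorem propTime_le_of_cover (hG : G.IsTree) {B : Set V} {k : ℕ}
    (h : ∀ x, ∃ b ∈ B, G.dist b x ≤ k) : propTime G B ≤ k :=
  iInf₂_le k ((blueAfter_eq_univ_iff hG).2 h)

theorem exists_cover_of_propTime_ne_top (hG : G.IsTree) {B : Set V} (h : propTime G B ≠ ⊤) :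
    ∃ k : ℕ, propTime G B = k ∧ ∀ x, ∃ b ∈ B, G.dist b x ≤ k := by
  classical
  have hex : ∃ k, blueAfter G B k = Set.univ := by
    by_contra! hne
    exact h (by simp [propTime, hne])
  refine ⟨Nat.find hex, le_antisymm (iInf₂_le (Nat.find hex) (Nat.find_spec hex)) ?_,
    (blueAfter_eq_univ_iff hG).1 (Nat.find_spec hex)⟩
  exact le_iInf₂ fun k hk => by exact_mod_cast Nat.find_min' hex hk

end PSD

/-! ### Throttling via covers, and branches -/

namespace WeightedGraph

theorem throttling_le_of_covers {T T' : WeightedGraph.{u}} (hT : T.graph.IsTree)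
    (hT' : T'.graph.IsTree)
    (h : ∀ (B' : Finset T'.V) (k : ℕ), (∀ x, ∃ b ∈ B', T'.graph.dist b x ≤ k) →
      ∃ B : Finset T.V, (∀ x, ∃ b ∈ B, T.graph.dist b x ≤ k) ∧
        ∑ x ∈ B, T.w x ≤ ∑ x ∈ B', T'.w x) :
    T.throttling ≤ T'.throttling := by
  refine le_iInf fun B' => ?_
  by_cases htop : PSD.propTime T'.graph (B' : Set T'.V) = ⊤
  · simp [throttlingOf, htop]
  obtain ⟨k, hk, hcov⟩ := PSD.exists_cover_of_propTime_ne_top hT' htop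
  obtain ⟨B, hB, hle⟩ := h B' k (by simpa using hcov)
  refine (iInf_le _ B).trans (add_le_add (by exact_mod_cast hle) ?_)
  rw [hk]
  exact_mod_cast PSD.propTime_le_of_cover hT (by simpa using hB)

theorem IsBranch.not_mem {T : WeightedGraph.{u}} {v : T.V} {S : Set T.V} (h : T.IsBranch v S) :
    v ∉ S := by
  obtain ⟨C, rfl⟩ := h
  rintro ⟨x, -, hx⟩
  exact x.2 hx

theorem IsBranch.mem_of_adj {T : WeightedGraph.{u}} {v : T.V} {S : Set T.V}
    (h : T.IsBranch v S) : ∀ x ∈ S, ∀ y, T.graph.Adj x y → y ≠ v → y ∈ S := by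
  obtain ⟨C, rfl⟩ := h
  rintro _ ⟨x, hx, rfl⟩ y hadj hy
  refine ⟨⟨y, hy⟩, ?_, rfl⟩
  have : (T.graph.induce {v}ᶜ).Adj x ⟨y, hy⟩ := hadj
  exact SimpleGraph.ConnectedComponent.mem_supp_of_adj_mem_supp _ hx this

theorem IsBranch.eq_of_mem {T : WeightedGraph.{u}} {v : T.V} {S S' : Set T.V}
    (h : T.IsBranch v S) (h' : T.IsBranch v S') {x : T.V} (hx : x ∈ S) (hx' : x ∈ S') :
    S = S' := by
  obtain ⟨C, rfl⟩ := h
  obtain ⟨C', rfl⟩ := h'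
  obtain ⟨a, ha, rfl⟩ := hx
  obtain ⟨b, hb, hab⟩ := hx'
  obtain rfl := Subtype.ext hab
  rw [SimpleGraph.ConnectedComponent.mem_supp_iff] at ha hb
  rw [← ha, ← hb]

/-! ### Folding symmetric branches -/

variable {T : WeightedGraph.{u}} {v : T.V} {F : Finset (Set T.V)} {S₁ : Set T.V}

/-- A graph homomorphism `fold` that folds all branches in `F` onto `S₁`, with automorphisms
`swap S` that carry `S₁` back to `S`. -/
structure BranchFold (T : WeightedGraph.{u}) (v : T.V) (F : Finset (Set T.V)) (S₁ : Set T.V) where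
  branch : ∀ S ∈ F, T.IsBranch v S
  mem : S₁ ∈ F
  fold : T.graph →g T.graph
  swap : Set T.V → (T.graph ≃g T.graph)
  fold_of_notMem : ∀ x, (∀ S ∈ F, x ∉ S) → fold x = x
  fold_base : ∀ x ∈ S₁, fold x = x
  fold_mem : ∀ S ∈ F, ∀ x ∈ S, fold x ∈ S₁
  swap_fold : ∀ S ∈ F, ∀ x ∈ S, swap S (fold x) = x
  swap_mem : ∀ S ∈ F, ∀ x ∈ S₁, swap S x ∈ S
  fold_swap : ∀ S ∈ F, ∀ x ∈ S₁, fold (swap S x) = x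
  swap_of_notMem : ∀ S ∈ F, ∀ x, (∀ S ∈ F, x ∉ S) → swap S x = x
  w_fold : ∀ x, T.w (fold x) = T.w x

/-- The fold acts on each branch `S` as the inverse of the automorphism carrying `S₁` to `S`. It
preserves edges because an edge leaving a branch ends at `v`, which all these automorphisms fix. -/
theorem IsSymmetricFamily.nonempty_branchFold (h : T.IsSymmetricFamily v (F : Set (Set T.V)))
    (h₁ : S₁ ∈ F) : Nonempty (BranchFold T v F S₁) := by
  classical
  have hbr : ∀ S ∈ F, T.IsBranch v S := fun S hS => h.1 S hS
  -- Symmetry is given only for distinct branches; the identity serves for `S₁` itself, and as a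
  -- default off `F`.
  have hex : ∀ S : Set T.V, ∃ σ : T.graph ≃g T.graph, (S = S₁ → ∀ x, σ x = x) ∧ (S ∈ F →
      (∀ x, x ∉ S₁ ∪ S → σ x = x) ∧ σ '' S₁ = S ∧ ∀ x ∈ S₁, T.w x = T.w (σ x)) := by
    intro S
    by_cases hS : S = S₁
    · subst hS
      exact ⟨SimpleGraph.Iso.refl, fun _ _ => rfl, fun _ => ⟨fun _ _ => rfl, by simp, by simp⟩⟩
    by_cases hSF : S ∈ F
    · obtain ⟨σ, h1, h2, -, h4⟩ := h.2 h₁ hSF (Ne.symm hS)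
      exact ⟨σ, fun h => absurd h hS, fun _ => ⟨h1, h2, h4⟩⟩
    · exact ⟨SimpleGraph.Iso.refl, fun _ _ => rfl, fun h => absurd h hSF⟩
  choose σ hσ₁ hσ using hex
  let φ : T.V → T.V := fun x => if hx : ∃ S ∈ F, x ∈ S then (σ hx.choose).symm x else x
  have hφ : ∀ S ∈ F, ∀ x ∈ S, φ x = (σ S).symm x := by
    intro S hS x hx
    have hex : ∃ S ∈ F, x ∈ S := ⟨S, hS, hx⟩
    have heq : hex.choose = S :=
      (hbr _ hex.choose_spec.1).eq_of_mem (hbr S hS) hex.choose_spec.2 hx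
    simp only [φ, dif_pos hex, heq]
  have hφ' : ∀ x, (∀ S ∈ F, x ∉ S) → φ x = x := by
    intro x hx
    have : ¬ ∃ S ∈ F, x ∈ S := by simpa using hx
    simp only [φ, dif_neg this]
  have hfix : ∀ S ∈ F, ∀ x, (∀ S ∈ F, x ∉ S) → σ S x = x := fun S hS x hx =>
    (hσ S hS).1 x (by simp [hx S hS, hx S₁ h₁])
  have hv : ∀ S ∈ F, v ∉ S := fun S hS => (hbr S hS).not_mem
  have hsm : ∀ S ∈ F, ∀ x ∈ S₁, σ S x ∈ S := by
    intro S hS x hx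
    have : σ S x ∈ σ S '' S₁ := ⟨x, hx, rfl⟩
    rwa [(hσ S hS).2.1] at this
  have hfm : ∀ S ∈ F, ∀ x ∈ S, φ x ∈ S₁ := by
    intro S hS x hx
    obtain ⟨y, hy, rfl⟩ : x ∈ σ S '' S₁ := by rwa [(hσ S hS).2.1]
    rw [hφ S hS _ hx]
    simpa using hy
  have hsf : ∀ S ∈ F, ∀ x ∈ S, σ S (φ x) = x := by
    intro S hS x hx
    rw [hφ S hS x hx]
    simp
  have hhom_mem : ∀ S ∈ F, ∀ x ∈ S, ∀ y, T.graph.Adj x y → T.graph.Adj (φ x) (φ y) := by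
    intro S hS x hx y hxy
    have hy : φ y = (σ S).symm y := by
      by_cases hyv : y = v
      · subst hyv
        rw [hφ' y hv, RelIso.eq_symm_apply]
        exact hfix S hS y hv
      · exact hφ S hS y ((hbr S hS).mem_of_adj x hx y hxy hyv)
    rw [hφ S hS x hx, hy]
    exact (σ S).symm.map_rel_iff.2 hxy
  exact ⟨{
    branch := hbr
    mem := h₁
    fold := ⟨φ, by
      intro x y hxy
      by_cases hx : ∃ S ∈ F, x ∈ S
      · obtain ⟨S, hS, hx⟩ := hx
        exact hhom_mem S hS x hx y hxy
      by_cases hy : ∃ S ∈ F, y ∈ S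
      · obtain ⟨S, hS, hy⟩ := hy
        exact (hhom_mem S hS y hy x hxy.symm).symm
      push Not at hx hy
      rwa [hφ' x hx, hφ' y hy]⟩
    swap := σ
    fold_of_notMem := hφ'
    fold_base := by
      intro x hx
      change φ x = x
      rw [hφ S₁ h₁ x hx, RelIso.symm_apply_eq]
      exact (hσ₁ S₁ rfl x).symm
    fold_mem := hfm
    swap_fold := hsf
    swap_mem := hsm
    fold_swap := by
      intro S hS x hx
      change φ _ = x
      rw [hφ S hS _ (hsm S hS x hx)]
      simp
    swap_of_notMem := hfix
    w_fold := by
      intro x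
      change T.w (φ x) = T.w x
      by_cases hx : ∃ S ∈ F, x ∈ S
      · obtain ⟨S, hS, hx⟩ := hx
        rw [(hσ S hS).2.2 _ (hfm S hS x hx), hsf S hS x hx]
      · push Not at hx
        rw [hφ' x hx] }⟩

open Classical in
/-- The weights after the branches in `F` have been concentrated on `S₁`. -/
noncomputable def concentratedWeight (T : WeightedGraph.{u}) (F : Finset (Set T.V))
    (S₁ : Set T.V) (x : T.V) : ℝ≥0 :=
  if x ∈ S₁ then F.card * T.w x else T.w x

/-! ### Unfolding and folding covers -/

namespace BranchFold

theorem fold_root (f : BranchFold T v F S₁) : f.fold v = v :=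
  f.fold_of_notMem v fun S hS => (f.branch S hS).not_mem

theorem fold_eq_self (f : BranchFold T v F S₁) {x : T.V} (h : ∀ S ∈ F, S ≠ S₁ → x ∉ S) :
    f.fold x = x := by
  by_cases hx : x ∈ S₁
  · exact f.fold_base x hx
  · refine f.fold_of_notMem x fun S hS => ?_
    by_cases hS₁ : S = S₁
    · rwa [hS₁]
    · exact h S hS hS₁

theorem fold_notMem (f : BranchFold T v F S₁) (x : T.V) :
    ∀ S ∈ F, S ≠ S₁ → f.fold x ∉ S := by
  intro S hS hS₁ hmem
  by_cases hx : ∃ S ∈ F, x ∈ S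
  · obtain ⟨S', hS', hx⟩ := hx
    exact hS₁ ((f.branch S hS).eq_of_mem (f.branch S₁ f.mem) hmem (f.fold_mem S' hS' x hx))
  · push Not at hx
    rw [f.fold_of_notMem x hx] at hmem
    exact hx S hS hmem

/-- A cover of the concentrated tree unfolds to a cover of the original tree of no larger
weight. -/
theorem exists_unfolded_cover (f : BranchFold T v F S₁) {C : Finset T.V}
    (hC : ∀ c ∈ C, f.fold c = c) {k : ℕ}
    (hcov : ∀ x, ∃ c ∈ C, T.graph.dist c (f.fold x) ≤ k) (hT : T.graph.Connected) :
    ∃ B : Finset T.V, (∀ x, ∃ b ∈ B, T.graph.dist b x ≤ k) ∧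
      ∑ x ∈ B, T.w x ≤ ∑ c ∈ C, concentratedWeight T F S₁ c := by
  classical
  have := T.finite
  have := Fintype.ofFinite T.V
  refine ⟨Finset.univ.filter fun x => f.fold x ∈ C, fun x => ?_, ?_⟩
  · obtain ⟨c, hc, hd⟩ := hcov x
    by_cases hx : ∃ S ∈ F, x ∈ S
    · obtain ⟨S, hS, hx⟩ := hx
      -- `swap S` carries `f.fold x` back to `x`, and `c` to a vertex in the fibre of `c`.
      refine ⟨f.swap S c, ?_, ?_⟩
      · have : f.fold (f.swap S c) = c := by
          by_cases hc₁ : c ∈ S₁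
          · exact f.fold_swap S hS c hc₁
          · have hcF : ∀ S ∈ F, c ∉ S := fun S' hS' hcS' =>
              hc₁ (hC c hc ▸ f.fold_mem S' hS' c hcS')
            rw [f.swap_of_notMem S hS c hcF, hC c hc]
        simpa [this] using hc
      · have h := hT.dist_map_le (f.swap S).toHom c (f.fold x)
        change T.graph.dist (f.swap S c) (f.swap S (f.fold x)) ≤ _ at h
        rw [f.swap_fold S hS x hx] at h
        exact h.trans hd
    · push Not at hx
      rw [f.fold_of_notMem x hx] at hd
      exact ⟨c, by simpa [hC c hc] using hc, hd⟩
  · rw [← Finset.sum_fiberwise_of_maps_to (s := Finset.univ.filter fun x => f.fold x ∈ C) (t := C)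
      (g := f.fold) (by simp)]
    refine Finset.sum_le_sum fun c hc => ?_
    have hsum : ∀ D : Finset T.V, (∀ x ∈ D, f.fold x = c) →
        ∑ x ∈ D, T.w x = D.card * T.w c := by
      intro D hD
      rw [Finset.sum_congr rfl fun x hx => (by rw [← hD x hx, f.w_fold] : T.w x = T.w c)]
      simp
    rw [hsum _ (by simp)]
    unfold concentratedWeight
    split_ifs with hc₁
    · gcongr
      -- Each vertex in the fibre of `c` is `swap S c` for some `S ∈ F`.
      refine le_trans (Finset.card_le_card ?_) (Finset.card_image_le (s := F)
        (f := fun S => f.swap S c))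
      intro x hx
      simp only [Finset.mem_filter] at hx
      by_cases hxF : ∃ S ∈ F, x ∈ S
      · obtain ⟨S, hS, hxS⟩ := hxF
        exact Finset.mem_image.2 ⟨S, hS, by rw [← hx.2, f.swap_fold S hS x hxS]⟩
      · push Not at hxF
        rw [f.fold_of_notMem x hxF] at hx
        exact absurd (hx.2 ▸ hc₁) (hxF S₁ f.mem)
    · refine mul_le_of_le_one_left' ?_
      have : ∀ x ∈ (Finset.univ.filter fun x => f.fold x ∈ C).filter (fun x => f.fold x = c),
          x = c := by
        intro x hx
        simp only [Finset.mem_filter] at hx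
        rw [← hx.2]
        exact (f.fold_of_notMem x fun S hS hxS => hc₁ (hx.2 ▸ f.fold_mem S hS x hxS)).symm
      exact_mod_cast Finset.card_le_one.2 fun a ha b hb => (this a ha).trans (this b hb).symm

/-- If `c ∈ C` is at least as close to the root as every vertex of `B`, then the fold of `B`
outside the branches and inside one branch `S`, together with `c`, covers the folded tree. -/
theorem cover_fold (f : BranchFold T v F S₁) (hT : T.graph.Connected) {B C : Finset T.V} {k : ℕ}
    (hB : ∀ x, ∃ b ∈ B, T.graph.dist b x ≤ k) {S : Set T.V} (hS : S ∈ F)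
    (hC : ∀ b ∈ B, (∀ S ∈ F, b ∉ S) → b ∈ C) (hCS : ∀ b ∈ B, b ∈ S → f.fold b ∈ C)
    {c : T.V} (hc : c ∈ C) (hcv : ∀ b ∈ B, T.graph.dist c v ≤ T.graph.dist b v) (x : T.V) :
    ∃ b ∈ C, T.graph.dist b (f.fold x) ≤ k := by
  -- If `b` covers `y` from inside a branch missing `y`, the route passes `v`, so `c` covers the
  -- fold of `y`.
  have hvia : ∀ y b, b ∈ B → ∀ R ∈ F, b ∈ R → y ∉ R → T.graph.dist b y ≤ k →
      f.fold y = f.fold x → ∃ b ∈ C, T.graph.dist b (f.fold x) ≤ k := by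
    intro y b hb R hR hbR hyR hd hyx
    refine ⟨c, hc, ?_⟩
    have h1 := hT.dist_add_dist_le_of_leaves (f.branch R hR).mem_of_adj hbR hyR
    have h2 := hT.dist_map_le f.fold v y
    rw [f.fold_root, hyx] at h2
    have h3 := hT.dist_triangle (u := c) (v := v) (w := f.fold x)
    have h4 := hcv b hb
    omega
  by_cases hx : ∃ R ∈ F, x ∈ R
  · obtain ⟨R, hR, hxR⟩ := hx
    have hfx := f.fold_mem R hR x hxR
    -- Test the copy of `x` in `S`: a vertex covering it from inside `S` has its fold in `C`.
    obtain ⟨b, hb, hd⟩ := hB (f.swap S (f.fold x))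
    have hyx : f.fold (f.swap S (f.fold x)) = f.fold x := f.fold_swap S hS _ hfx
    have hyS : f.swap S (f.fold x) ∈ S := f.swap_mem S hS _ hfx
    by_cases hbS : b ∈ S
    · refine ⟨f.fold b, hCS b hb hbS, ?_⟩
      have := hT.dist_map_le f.fold b (f.swap S (f.fold x))
      rw [hyx] at this
      exact this.trans hd
    · by_cases hbF : ∃ Q ∈ F, b ∈ Q
      · obtain ⟨Q, hQ, hbQ⟩ := hbF
        refine hvia _ b hb Q hQ hbQ (fun hyQ => hbS ?_) hd hyx
        rwa [(f.branch S hS).eq_of_mem (f.branch Q hQ) hyS hyQ]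
      · push Not at hbF
        refine ⟨b, hC b hb hbF, ?_⟩
        have := hT.dist_map_le f.fold b (f.swap S (f.fold x))
        rw [hyx, f.fold_of_notMem b hbF] at this
        exact this.trans hd
  · push Not at hx
    obtain ⟨b, hb, hd⟩ := hB x
    by_cases hbF : ∃ Q ∈ F, b ∈ Q
    · obtain ⟨Q, hQ, hbQ⟩ := hbF
      exact hvia x b hb Q hQ hbQ (hx Q hQ) hd rfl
    · push Not at hbF
      rw [f.fold_of_notMem x hx]
      exact ⟨b, hC b hb hbF, hd⟩

open Classical in
/-- The vertices of `B` outside all branches in `F`. -/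
noncomputable def outside (B : Finset T.V) (F : Finset (Set T.V)) : Finset T.V :=
  B.filter fun x => ∀ S ∈ F, x ∉ S

open Classical in
theorem sum_outside_add_sum_branches_le (f : BranchFold T v F S₁) (B : Finset T.V) :
    ∑ x ∈ outside B F, T.w x + ∑ S ∈ F, ∑ x ∈ B with x ∈ S, T.w x ≤ ∑ x ∈ B, T.w x := by
  rw [← Finset.sum_biUnion, ← Finset.sum_union]
  · refine Finset.sum_le_sum_of_subset fun x hx => ?_
    simp only [outside, Finset.mem_union, Finset.mem_filter, Finset.mem_biUnion] at hx
    rcases hx with h | ⟨_, _, h, _⟩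
    exacts [h.1, h]
  · rw [Finset.disjoint_left]
    intro x hx hx'
    simp only [outside, Finset.mem_filter, Finset.mem_biUnion] at hx hx'
    obtain ⟨S, hS, -, hxS⟩ := hx'
    exact hx.2 S hS hxS
  · intro S hS R hR hne
    refine Finset.disjoint_left.2 fun x hx hx' => hne ?_
    simp only [Finset.mem_filter] at hx hx'
    exact (f.branch S hS).eq_of_mem (f.branch R hR) hx.2 hx'.2

open Classical in
-- `swap S` undoes the fold on `S`, so folding is injective there and only multiplies weights by
-- `F.card`.
theorem sum_concentratedWeight_le (f : BranchFold T v F S₁) (B : Finset T.V) {S : Set T.V}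
    (hS : S ∈ F) :
    ∑ x ∈ outside B F ∪ (B.filter (· ∈ S)).image f.fold, concentratedWeight T F S₁ x ≤
      ∑ x ∈ outside B F, T.w x + F.card * ∑ x ∈ B with x ∈ S, T.w x := by
  have h := Finset.sum_union_inter (s₁ := outside B F)
    (s₂ := (B.filter (· ∈ S)).image f.fold) (f := concentratedWeight T F S₁)
  refine (le_self_add.trans h.le).trans (add_le_add (le_of_eq ?_) (le_of_eq ?_))
  · refine Finset.sum_congr rfl fun x hx => ?_
    simp only [outside, Finset.mem_filter] at hx
    simp [concentratedWeight, hx.2 S₁ f.mem]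
  · rw [Finset.sum_image, Finset.mul_sum]
    · refine Finset.sum_congr rfl fun x hx => ?_
      simp only [Finset.mem_filter] at hx
      simp [concentratedWeight, f.fold_mem S hS x hx.2, f.w_fold]
    · intro x hx y hy hxy
      simp only [Finset.coe_filter, Set.mem_ofPred_eq] at hx hy
      rw [← f.swap_fold S hS x hx.2, hxy, f.swap_fold S hS y hy.2]

/-- A cover of the original tree can be replaced by a cover of the concentrated tree of no larger
weight. -/
theorem exists_folded_cover (f : BranchFold T v F S₁) (hT : T.graph.Connected)
    (hw : T.IsIntegerWeighted) (hv : T.w v = 1) {B : Finset T.V} {k : ℕ}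
    (hB : ∀ x, ∃ b ∈ B, T.graph.dist b x ≤ k) :
    ∃ C : Finset T.V, (∀ c ∈ C, f.fold c = c) ∧ (∀ x, ∃ c ∈ C, T.graph.dist c (f.fold x) ≤ k) ∧
      ∑ c ∈ C, concentratedWeight T F S₁ c ≤ ∑ x ∈ B, T.w x := by
  classical
  choose n hn using hw
  obtain ⟨S, hS, hmin⟩ := F.exists_min_image (fun S => ∑ x ∈ B with x ∈ S, n x) ⟨S₁, f.mem⟩
  obtain ⟨a, ha, hclose⟩ := B.exists_min_image (fun b => T.graph.dist b v)
    (let ⟨b, hb, _⟩ := hB v; ⟨b, hb⟩)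
  have hfold : ∀ R : Set T.V, ∀ c ∈ outside B F ∪ (B.filter (· ∈ R)).image f.fold, f.fold c = c := by
    intro R c hc
    rw [Finset.mem_union, Finset.mem_image] at hc
    rcases hc with hc | ⟨b, -, rfl⟩
    · exact f.fold_of_notMem c (Finset.mem_filter.1 hc).2
    · exact f.fold_eq_self (f.fold_notMem b)
  have hout : ∀ R : Set T.V, ∀ b ∈ B, (∀ S ∈ F, b ∉ S) →
      b ∈ outside B F ∪ (B.filter (· ∈ R)).image f.fold := fun R b hb hbF =>
    Finset.mem_union_left _ (Finset.mem_filter.2 ⟨hb, hbF⟩)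
  have hin : ∀ R : Set T.V, ∀ b ∈ B, b ∈ R →
      f.fold b ∈ outside B F ∪ (B.filter (· ∈ R)).image f.fold := fun R b hb hbR =>
    Finset.mem_union_right _ (Finset.mem_image_of_mem _ (Finset.mem_filter.2 ⟨hb, hbR⟩))
  have hminimal : ∀ R ∈ F, (∀ Q ∈ F, ∑ x ∈ B with x ∈ R, n x ≤ ∑ x ∈ B with x ∈ Q, n x) →
      (F.card : ℝ≥0) * ∑ x ∈ B with x ∈ R, T.w x ≤ ∑ S ∈ F, ∑ x ∈ B with x ∈ S, T.w x := by
    intro R hR hRmin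
    have := F.card_nsmul_le_sum _ _ hRmin
    simp only [hn, smul_eq_mul] at this ⊢
    exact_mod_cast this
  -- No extra vertex is needed here: the fold of `a` is kept and is still at least as close to `v`
  -- as all of `B`.
  have key : ∀ R ∈ F, (∀ Q ∈ F, ∑ x ∈ B with x ∈ R, n x ≤ ∑ x ∈ B with x ∈ Q, n x) →
      (a ∈ R ∨ ∀ Q ∈ F, a ∉ Q) →
      ∃ C : Finset T.V, (∀ c ∈ C, f.fold c = c) ∧
        (∀ x, ∃ c ∈ C, T.graph.dist c (f.fold x) ≤ k) ∧
        ∑ c ∈ C, concentratedWeight T F S₁ c ≤ ∑ x ∈ B, T.w x := by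
    intro R hR hRmin haR
    refine ⟨_, hfold R, ?_, (f.sum_concentratedWeight_le B hR).trans
      ((add_le_add le_rfl (hminimal R hR hRmin)).trans (f.sum_outside_add_sum_branches_le B))⟩
    have hfa : f.fold a ∈ outside B F ∪ (B.filter (· ∈ R)).image f.fold := by
      rcases haR with h | h
      · exact hin R a ha h
      · rw [f.fold_of_notMem a h]
        exact hout R a ha h
    refine f.cover_fold hT hB hR (hout R) (hin R) hfa fun b hb => ?_
    have := hT.dist_map_le f.fold a v
    rw [f.fold_root] at this
    exact this.trans (hclose b hb)
  by_cases haF : ∃ R ∈ F, a ∈ R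
  · obtain ⟨R, hR, haR⟩ := haF
    by_cases hlt : ∑ x ∈ B with x ∈ S, n x < ∑ x ∈ B with x ∈ R, n x
    · refine ⟨insert v (outside B F ∪ (B.filter (· ∈ S)).image f.fold), ?_, ?_, ?_⟩
      · intro c hc
        rcases Finset.mem_insert.1 hc with rfl | hc
        · exact f.fold_root
        · exact hfold S c hc
      · exact f.cover_fold hT hB hS (fun b hb h => Finset.mem_insert_of_mem (hout S b hb h))
          (fun b hb h => Finset.mem_insert_of_mem (hin S b hb h)) (Finset.mem_insert_self v _)
          (by simp)
      · have h1 : ∑ c ∈ insert v (outside B F ∪ (B.filter (· ∈ S)).image f.fold),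
            concentratedWeight T F S₁ c ≤ 1 + ∑ c ∈ outside B F ∪ (B.filter (· ∈ S)).image f.fold,
            concentratedWeight T F S₁ c := by
          have hv1 : concentratedWeight T F S₁ v = 1 := by
            simp [concentratedWeight, (f.branch S₁ f.mem).not_mem, hv]
          by_cases hmem : v ∈ outside B F ∪ (B.filter (· ∈ S)).image f.fold
          · rw [Finset.insert_eq_of_mem hmem]
            exact le_add_self
          · rw [Finset.sum_insert hmem, hv1]
        have h2 : 1 + (F.card : ℝ≥0) * ∑ x ∈ B with x ∈ S, T.w x ≤
            ∑ S ∈ F, ∑ x ∈ B with x ∈ S, T.w x := by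
          have h3 := (F.sum_lt_sum (f := fun _ => ∑ x ∈ B with x ∈ S, n x) hmin ⟨R, hR, hlt⟩)
          simp only [Finset.sum_const, smul_eq_mul] at h3
          -- Integrality turns the strict inequality into a gap of 1, the weight of `v`.
          have h4 : 1 + F.card * ∑ x ∈ B with x ∈ S, n x ≤ ∑ S ∈ F, ∑ x ∈ B with x ∈ S, n x := by
            omega
          simp only [hn]
          exact_mod_cast h4
        calc _ ≤ _ := h1
          _ ≤ _ := add_le_add le_rfl (f.sum_concentratedWeight_le B hS)
          _ = ∑ x ∈ outside B F, T.w x + (1 + F.card * ∑ x ∈ B with x ∈ S, T.w x) := by ring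
          _ ≤ _ := add_le_add le_rfl h2
          _ ≤ _ := f.sum_outside_add_sum_branches_le B
    -- The branch containing `a` is itself lightest, so it is folded instead of `S`.
    · exact key R hR (fun Q hQ => (not_lt.1 hlt).trans (hmin Q hQ)) (Or.inl haR)
  · push Not at haF
    exact key S hS hmin (Or.inr haF)

end BranchFold

/-! ### Invariance under concentration -/

theorem IsSingleConcentration.isTree_and_isIntegerWeighted_and_throttling_eq
    {T' : WeightedGraph.{u}} (h : T.IsSingleConcentration T') (hT : T.graph.IsTree)
    (hw : T.IsIntegerWeighted) :
    T'.graph.IsTree ∧ T'.IsIntegerWeighted ∧ T.throttling = T'.throttling := by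
  classical
  obtain ⟨v, F, S₁, hv, hF, h₁, e, he⟩ := h
  have := T.finite
  have := Fintype.ofFinite T.V
  obtain ⟨F, rfl⟩ : ∃ F' : Finset (Set T.V), F = F' :=
    ⟨F.toFinite.toFinset, by simp⟩
  obtain ⟨f⟩ := hF.prop.nonempty_branchFold h₁
  have hmem : ∀ x, f.fold x ∈ (⋃₀ ((F : Set (Set T.V)) \ {S₁}))ᶜ := by
    rintro x ⟨S, ⟨hS, hne⟩, hx⟩
    exact f.fold_notMem x S hS hne hx
  let i : T'.graph →g T.graph := ⟨fun y => (e y).1, fun {a b} hab => e.map_rel_iff.2 hab⟩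
  -- `r` is a retraction for `i`; as both are homomorphisms, `i` preserves distances exactly.
  let r : T.graph →g T'.graph := ⟨fun x => e.symm ⟨f.fold x, hmem x⟩, fun {a b} hab => by
    apply e.symm.map_rel_iff.2
    exact f.fold.map_rel hab⟩
  have hi : Function.Injective i := fun a b hab => e.injective (Subtype.ext hab)
  have hfi : ∀ y, f.fold (i y) = i y := fun y =>
    f.fold_eq_self fun S hS hne hy => (e y).2 ⟨S, ⟨hS, hne⟩, hy⟩
  have hri : ∀ y, r (i y) = y := by
    intro y
    change e.symm ⟨f.fold (i y), _⟩ = y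
    rw [RelIso.symm_apply_eq]
    exact Subtype.ext (hfi y)
  have hir : ∀ x, i (r x) = f.fold x := by
    intro x
    change (e (e.symm ⟨f.fold x, _⟩)).1 = _
    rw [RelIso.apply_symm_apply]
  have hT' : T'.graph.IsTree :=
    ⟨hT.connected.map r fun y => ⟨i y, hri y⟩, hT.isAcyclic.comap i hi⟩
  have hwt : ∀ y, T'.w y = concentratedWeight T F S₁ (i y) := by
    intro y
    unfold concentratedWeight
    split_ifs with h
    · rw [(he y).1 h, Set.ncard_coe_finset]
      rfl
    · exact (he y).2 h
  have hdist : ∀ a b, T'.graph.dist a b = T.graph.dist (i a) (i b) := by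
    intro a b
    refine le_antisymm ?_ (hT'.connected.dist_map_le i a b)
    have := hT.connected.dist_map_le r (i a) (i b)
    rwa [hri, hri] at this
  refine ⟨hT', ?_, le_antisymm ?_ ?_⟩
  · intro y
    obtain ⟨n, hn⟩ := hw (i y)
    rw [hwt]
    unfold concentratedWeight
    split_ifs
    · exact ⟨F.card * n, by rw [hn]; push_cast; rfl⟩
    · exact ⟨n, hn⟩
  · refine throttling_le_of_covers hT hT' fun B' k hB' => ?_
    have := f.exists_unfolded_cover (C := B'.image i) (k := k) (by
      intro c hc
      obtain ⟨y, -, rfl⟩ := Finset.mem_image.1 hc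
      exact hfi y) (by
      intro x
      obtain ⟨b, hb, hd⟩ := hB' (r x)
      rw [hdist, hir] at hd
      exact ⟨i b, Finset.mem_image_of_mem _ hb, hd⟩) hT.connected
    rw [Finset.sum_image hi.injOn] at this
    simpa only [hwt] using this
  · refine throttling_le_of_covers hT' hT fun B k hB => ?_
    obtain ⟨C, hC, hcov, hle⟩ := f.exists_folded_cover hT.connected hw hv hB
    have hirC : ∀ c ∈ C, i (r c) = c := fun c hc => (hir c).trans (hC c hc)
    refine ⟨C.image r, fun y => ?_, ?_⟩
    · obtain ⟨c, hc, hd⟩ := hcov (i y)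
      refine ⟨r c, Finset.mem_image_of_mem _ hc, ?_⟩
      rwa [hdist, hirC c hc, ← hfi y]
    · rw [Finset.sum_image fun a ha b hb hab => by rw [← hirC a ha, hab, hirC b hb]]
      refine le_trans (le_of_eq ?_) hle
      exact Finset.sum_congr rfl fun c hc => by rw [hwt, hirC c hc]

end WeightedGraph

theorem mainTheorem3 (T T' : WeightedGraph.{u}) (hT : T.graph.IsTree)
    (hw : T.IsIntegerWeighted) (h : T.IsConcentration T') :
    T.throttling = T'.throttling := by
  -- Being a tree and having integer weights are carried along, since the next concentration
  -- requires both.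
  have key : T'.graph.IsTree ∧ T'.IsIntegerWeighted ∧ T.throttling = T'.throttling := by
    induction h with
    | single h => exact h.isTree_and_isIntegerWeighted_and_throttling_eq hT hw
    | tail _ h ih =>
      obtain ⟨h1, h2, h3⟩ := ih
      obtain ⟨h4, h5, h6⟩ := h.isTree_and_isIntegerWeighted_and_throttling_eq h1 h2
      exact ⟨h4, h5, h3.trans h6⟩
  exact key.2.2
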